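/- Let $G$ be a finite weighted tree with at least two nodes: a finite connected acyclic graph on a node set $\mathcal N$ with symmetric link weights $c_{ij}>0$ on the links (and $c_{ij}=0$ if $i,j$ are not linked). A distribution on $G$ is a function $p:\mathcal N\to\mathbb R$ with $p_i\ge 0$ and $\sum_i p_i=1$. For a function $d:\mathcal N\times\mathcal N\to\mathbb R$, the variance of $p$ with respect to $d$ is $\operatorname{var}_d(p)=\frac12\sum_{i,j}p_ip_j\,d(i,j)^2$, and a maximum variance distribution with respect to $d$ is a distribution that maximizes $\operatorname{var}_d$ over all distributions. The support of $p$ is $\{i:p_i>0\}$, and a leaf is a node with exactly one incident link. Let $Q$ be the Laplacian matrix ($Q_{ii}=\sum_k c_{ik}$, $Q_{ij}=-c_{ij}$ for $i\ne j$), $Q^\dagger$ its Moore–Penrose pseudoinverse, and $\omega_{ij}=(e_i-e_j)^TQ^\dagger(e_i-e_j)$ the effective resistance. (a) The support $\mathcal V^\star$ of the maximum variance distribution with respect to the square root effective resistance $\sqrt{\omega}$, i.e. of every distribution $p$ that maximizes $\operatorname{var}_{\sqrt\omega}(p)=\frac12\sum_{i,j}p_ip_j\omega_{ij}$, consists only of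 leaves. (b) More generally, let $d:\mathcal N\times\mathcal N\to\mathbb R$ be any distance function ($d(i,i)=0$, $d(i,j)=d(j,i)$, and $d(i,j)>0$ for $i\neq j$) that is additive across cut vertices: $d(i,j)=d(i,x)+d(x,j)$ whenever removing the node $x$ from $G$ disconnects $i$ and $j$. Then the support of every maximum variance distribution with respect to $\sqrt d$ (that is, with $d$ in the role of $\omega$), and likewise of every maximum variance distribution with respect to $d$ itself, consists only of leaves. -/

import Mathlib

namespace GraphVariance

/-- A weighted graph without loops on the node set `V`. The pair `i, j` is a link iff
`weight i j > 0`; `weight i j = 0` means that there is no link. -/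
structure WeightedGraph (V : Type*) where
  weight : V → V → ℝ
  weight_nonneg : ∀ i j, 0 ≤ weight i j
  weight_symm : ∀ i j, weight i j = weight j i
  weight_self : ∀ i, weight i i = 0

/-- `X` is the Moore-Penrose inverse of the real matrix `A` (the four Penrose equations). -/
structure IsMoorePenroseInverse {V : Type*} [Fintype V] (A X : Matrix V V ℝ) : Prop where
  mul_mul_left : A * X * A = A
  mul_mul_right : X * A * X = X
  symm_left : (A * X).transpose = A * X
  symm_right : (X * A).transpose = X * A

theorem IsMoorePenroseInverse.unique {V : Type*} [Fintype V] {A X Y : Matrix V V ℝ}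
    (hX : IsMoorePenroseInverse A X) (hY : IsMoorePenroseInverse A Y) : X = Y := by
  have h1 : A * X = A * Y := by
    calc A * X = (A * X).transpose := hX.symm_left.symm
      _ = (A * Y * (A * X)).transpose := by
          rw [← Matrix.mul_assoc, hY.mul_mul_left]
      _ = A * X * (A * Y) := by rw [Matrix.transpose_mul, hX.symm_left, hY.symm_left]
      _ = A * Y := by rw [← Matrix.mul_assoc, hX.mul_mul_left]
  have h2 : X * A = Y * A := by
    calc X * A = (X * A).transpose := hX.symm_right.symm
      _ = (X * A * (Y * A)).transpose := by
          rw [Matrix.mul_assoc, ← Matrix.mul_assoc A, hY.mul_mul_left]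
      _ = Y * A * (X * A) := by rw [Matrix.transpose_mul, hX.symm_right, hY.symm_right]
      _ = Y * A := by rw [Matrix.mul_assoc, ← Matrix.mul_assoc A, hX.mul_mul_left]
  calc X = X * A * X := hX.mul_mul_right.symm
    _ = Y * A * Y := by rw [h2, Matrix.mul_assoc, h1, ← Matrix.mul_assoc]
    _ = Y := hY.mul_mul_right

theorem exists_isMoorePenroseInverse {V : Type*} [Fintype V] [DecidableEq V]
    {A : Matrix V V ℝ} (hA : A.transpose = A) : ∃ X, IsMoorePenroseInverse A X := by
  have hH : A.IsHermitian := by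
    rw [Matrix.IsHermitian, Matrix.conjTranspose_eq_transpose_of_trivial, hA]
  obtain ⟨U, D, hU, hAU⟩ : ∃ (U : Matrix V V ℝ) (D : V → ℝ), U.transpose * U = 1 ∧
      A = U * Matrix.diagonal D * U.transpose := by
    refine ⟨(hH.eigenvectorUnitary : Matrix V V ℝ), hH.eigenvalues, ?_, ?_⟩
    · have := Unitary.coe_star_mul_self hH.eigenvectorUnitary
      rwa [Matrix.star_eq_conjTranspose, Matrix.conjTranspose_eq_transpose_of_trivial] at this
    · have := hH.spectral_theorem
      rw [Unitary.conjStarAlgAut_apply, Matrix.star_eq_conjTranspose,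
        Matrix.conjTranspose_eq_transpose_of_trivial] at this
      exact this
  have key : ∀ a b : V → ℝ, U * Matrix.diagonal a * U.transpose *
      (U * Matrix.diagonal b * U.transpose) =
      U * Matrix.diagonal (fun i => a i * b i) * U.transpose := by
    intro a b
    calc _ = U * Matrix.diagonal a * (U.transpose * U) * Matrix.diagonal b * U.transpose := by
            simp only [Matrix.mul_assoc]
      _ = _ := by
            rw [hU, Matrix.mul_one, Matrix.mul_assoc U, Matrix.diagonal_mul_diagonal]
  have tr : ∀ a : V → ℝ, (U * Matrix.diagonal a * U.transpose).transpose =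
      U * Matrix.diagonal a * U.transpose := by
    intro a
    simp [Matrix.transpose_mul, Matrix.mul_assoc]
  have inv_cancel : ∀ a : ℝ, a⁻¹ * a * a⁻¹ = a⁻¹ := fun a => by
    simpa using mul_inv_mul_cancel a⁻¹
  refine ⟨U * Matrix.diagonal (fun i => (D i)⁻¹) * U.transpose, ?_, ?_, ?_, ?_⟩ <;>
    simp only [hAU, key, tr, mul_inv_mul_cancel, inv_cancel]

open Classical in
/-- The Moore-Penrose inverse of a real square matrix. -/
noncomputable def pinv {V : Type*} [Fintype V] (A : Matrix V V ℝ) : Matrix V V ℝ :=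
  if h : ∃ X, IsMoorePenroseInverse A X then h.choose else 0

theorem pinv_spec {V : Type*} [Fintype V] [DecidableEq V]
    {A : Matrix V V ℝ} (hA : A.transpose = A) : IsMoorePenroseInverse A (pinv A) := by
  have h := exists_isMoorePenroseInverse hA
  rw [pinv, dif_pos h]
  exact h.choose_spec

namespace WeightedGraph

/-- The underlying simple graph, whose edges are the links. -/
def graph {V : Type*} (G : WeightedGraph V) : SimpleGraph V where
  Adj i j := 0 < G.weight i j
  symm := ⟨fun i j h => by rw [G.weight_symm j i]; exact h⟩
  loopless := ⟨fun i h => by rw [G.weight_self i] at h; exact lt_irrefl 0 h⟩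

/-- The Laplacian matrix: weighted degrees on the diagonal, minus the link weights off it. -/
def laplacian {V : Type*} [Fintype V] [DecidableEq V] (G : WeightedGraph V) : Matrix V V ℝ :=
  Matrix.of fun i j => if i = j then ∑ k, G.weight i k else -G.weight i j

/-- The effective resistance `ω i j = (e_i - e_j)ᵀ Q† (e_i - e_j)`. -/
noncomputable def effectiveResistance {V : Type*} [Fintype V] [DecidableEq V]
    (G : WeightedGraph V) (i j : V) : ℝ :=
  let e : V → ℝ := Pi.single i 1 - Pi.single j 1
  e ⬝ᵥ Matrix.mulVec (pinv G.laplacian) e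

end WeightedGraph

/-- The variance of `p` with respect to a distance `d` between the nodes. -/
noncomputable def variance {V : Type*} [Fintype V] (d : V → V → ℝ) (p : V → ℝ) : ℝ :=
  (1 / 2) * ∑ i, ∑ j, p i * p j * d i j ^ 2

/-- `p` is a maximum variance distribution with respect to the distance `d`. -/
def IsMaxVarianceDistribution {V : Type*} [Fintype V] (d : V → V → ℝ) (p : V → ℝ) : Prop :=
  p ∈ stdSimplex ℝ V ∧ IsMaxOn (variance d) (stdSimplex ℝ V) p

/-- A node with exactly one incident link. -/
def IsLeaf {V : Type*} (G : SimpleGraph V) (i : V) : Prop :=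
  ∃! j, G.Adj i j

/-- Removing the node `x` from the graph disconnects the nodes `i` and `j`. -/
def RemovalDisconnects {V : Type*} (G : SimpleGraph V) (x i j : V) : Prop :=
  ∃ (hi : i ∈ ({x}ᶜ : Set V)) (hj : j ∈ ({x}ᶜ : Set V)),
    ¬ (G.induce ({x}ᶜ : Set V)).Reachable ⟨i, hi⟩ ⟨j, hj⟩

/-- A distance function on the nodes; the triangle inequality is not required. -/
structure IsDistance {V : Type*} (d : V → V → ℝ) : Prop where
  self : ∀ i, d i i = 0
  pos : ∀ i j, i ≠ j → 0 < d i j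
  symm : ∀ i j, d i j = d j i

/-- `d` is additive across cut vertices of `G`. -/
def AdditiveAcrossCuts {V : Type*} (G : SimpleGraph V) (d : V → V → ℝ) : Prop :=
  ∀ x i j, RemovalDisconnects G x i j → d i j = d i x + d x j

end GraphVariance

/-!
At a maximum variance distribution `p`, the mean squared distance to a random node is maximal at
every node of the support (first-order optimality). Suppose that removing `x` separates `a` from
`b`, and let the squared distances be `φ (d i j)` with `φ` convex and increasing; `φ t = t` and
`φ t = t ^ 2` are the cases of `√d` and `d`. Every node `j` is beyond `x` as seen from `a` or from
`b`, say from `a`: then going from `x` to `a` lengthens the distance to `j` by `d a x`, while, by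
the triangle inequality, going from `x` to `b` shortens it by at most `d b x`. By convexity the
average of the two changes of `φ (d · j)`, with weights `d b x` and `d a x`, is nonnegative, and it
is positive for `j = x`. Hence `a` or `b` has a larger mean squared distance than `x`, and `x` is
not in the support. In a tree additivity implies the triangle inequality, and every node that is not
a leaf is such a cut vertex.

The effective resistance is the voltage between the two ends of a unit current; that it is a metric
additive across cut vertices follows from the maximum principle for the Laplacian.
-/

namespace GraphVariance

open Matrix

section FirstOrderOptimality

variable {V : Type*} [Fintype V] {d : V → V → ℝ} {p : V → ℝ}

/-- The mean squared distance from the node `i` to a random node with distribution `p`. Up to the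
factor `1 / 2`, the variance is its mean; for symmetric `d` it is the partial derivative of the
variance with respect to `p i`. -/
noncomputable def meanSqDist (d : V → V → ℝ) (p : V → ℝ) (i : V) : ℝ :=
  ∑ j, p j * d i j ^ 2

theorem variance_eq_dotProduct_meanSqDist (d : V → V → ℝ) (p : V → ℝ) :
    variance d p = 1 / 2 * (p ⬝ᵥ meanSqDist d p) := by
  simp only [variance, dotProduct, meanSqDist, Finset.mul_sum, mul_assoc]

theorem meanSqDist_add_smul (d : V → V → ℝ) (p e : V → ℝ) (t : ℝ) :
    meanSqDist d (p + t • e) = meanSqDist d p + t • meanSqDist d e := by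
  ext i
  simp only [meanSqDist, Pi.add_apply, Pi.smul_apply, smul_eq_mul, add_mul,
    Finset.sum_add_distrib, Finset.mul_sum, mul_assoc]

theorem dotProduct_meanSqDist_comm (hd : ∀ i j, d i j ^ 2 = d j i ^ 2) (p e : V → ℝ) :
    p ⬝ᵥ meanSqDist d e = e ⬝ᵥ meanSqDist d p := by
  simp only [dotProduct, meanSqDist, Finset.mul_sum]
  rw [Finset.sum_comm]
  refine Finset.sum_congr rfl fun i _ => Finset.sum_congr rfl fun j _ => ?_
  rw [hd]
  ring

theorem variance_add_smul (hd : ∀ i j, d i j ^ 2 = d j i ^ 2) (p e : V → ℝ) (t : ℝ) :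
    variance d (p + t • e) =
      variance d p + t * (e ⬝ᵥ meanSqDist d p) + t ^ 2 * variance d e := by
  simp only [variance_eq_dotProduct_meanSqDist, meanSqDist_add_smul, add_dotProduct,
    dotProduct_add, smul_dotProduct, dotProduct_smul, smul_eq_mul,
    dotProduct_meanSqDist_comm hd p e]
  ring

theorem nonpos_of_forall_mul_add_sq_mul_nonpos {b c : ℝ}
    (h : ∀ t, 0 < t → t ≤ 1 → t * b + t ^ 2 * c ≤ 0) : b ≤ 0 := by
  by_contra! hb
  have hpos : 0 < b + |c| := by positivity
  set t := b / (b + |c|)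
  have ht : 0 < t := by positivity
  have htc : t * (b + |c|) = b := div_mul_cancel₀ b hpos.ne'
  have hle := h t ht (div_le_one_of_le₀ (le_add_of_nonneg_right (abs_nonneg c)) hpos.le)
  have hfactor : b + t * c ≤ 0 := nonpos_of_mul_nonpos_right (by linarith) ht
  linarith [mul_pos ht hb, mul_le_mul_of_nonneg_left (neg_abs_le c) ht.le]

theorem IsMaxVarianceDistribution.dotProduct_meanSqDist_le (hp : IsMaxVarianceDistribution d p)
    (hd : ∀ i j, d i j ^ 2 = d j i ^ 2) {q : V → ℝ} (hq : q ∈ stdSimplex ℝ V) :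
    q ⬝ᵥ meanSqDist d p ≤ p ⬝ᵥ meanSqDist d p := by
  rw [← sub_nonpos, ← sub_dotProduct]
  refine nonpos_of_forall_mul_add_sq_mul_nonpos (c := variance d (q - p)) fun t ht₀ ht₁ => ?_
  have hmem : p + t • (q - p) ∈ stdSimplex ℝ V :=
    (convex_stdSimplex ℝ V).add_smul_sub_mem hp.1 hq ⟨ht₀.le, ht₁⟩
  have hle : variance d (p + t • (q - p)) ≤ variance d p := hp.2 hmem
  rw [variance_add_smul hd] at hle
  linarith

/-- By `dotProduct_meanSqDist_le`, `meanSqDist d p` is at most its own mean under `p`; hence it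
equals this mean wherever `p` is positive. -/
theorem IsMaxVarianceDistribution.meanSqDist_le_meanSqDist (hp : IsMaxVarianceDistribution d p)
    (hd : ∀ i j, d i j ^ 2 = d j i ^ 2) {x : V} (hx : 0 < p x) (a : V) :
    meanSqDist d p a ≤ meanSqDist d p x := by
  classical
  have hle : ∀ i, meanSqDist d p i ≤ p ⬝ᵥ meanSqDist d p := fun i => by
    simpa only [single_one_dotProduct] using
      hp.dotProduct_meanSqDist_le hd (single_mem_stdSimplex ℝ i)
  have hsum : ∑ i, p i * (p ⬝ᵥ meanSqDist d p - meanSqDist d p i) = 0 := by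
    simp only [mul_sub, Finset.sum_sub_distrib, ← Finset.sum_mul, hp.1.2, one_mul]
    exact sub_self _
  have hzero := (Finset.sum_eq_zero_iff_of_nonneg fun i _ =>
    mul_nonneg (hp.1.1 i) (sub_nonneg.2 (hle i))).1 hsum x (Finset.mem_univ x)
  have hmean := sub_eq_zero.1 ((mul_eq_zero.1 hzero).resolve_left hx.ne')
  exact (hle a).trans_eq hmean

end FirstOrderOptimality

section CutVertex

variable {V : Type*} {G : SimpleGraph V} {d : V → V → ℝ} {φ : ℝ → ℝ}

/-- A cut vertex in the sense that removing `x` separates two other nodes. If `G` is not connected,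
the two nodes may lie in different components of `G` itself. -/
def IsCutVertex (G : SimpleGraph V) (x : V) : Prop :=
  ∃ a b, RemovalDisconnects G x a b

theorem RemovalDisconnects.or_of_ne {x a b j : V} (h : RemovalDisconnects G x a b) (hj : j ≠ x) :
    RemovalDisconnects G x a j ∨ RemovalDisconnects G x b j := by
  obtain ⟨ha, hb, hab⟩ := h
  by_contra! hnot
  have haj : (G.induce {x}ᶜ).Reachable ⟨a, ha⟩ ⟨j, hj⟩ := by
    by_contra hr
    exact hnot.1 ⟨ha, hj, hr⟩
  have hbj : (G.induce {x}ᶜ).Reachable ⟨b, hb⟩ ⟨j, hj⟩ := by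
    by_contra hr
    exact hnot.2 ⟨hb, hj, hr⟩
  exact hab (haj.trans hbj.symm)

theorem IsDistance.nonneg (hd : IsDistance d) (i j : V) : 0 ≤ d i j := by
  rcases eq_or_ne i j with rfl | hij
  · exact (hd.self i).ge
  · exact (hd.pos i j hij).le

theorem AdditiveAcrossCuts.eq_add_or_eq_add (hadd : AdditiveAcrossCuts G d) (hd : IsDistance d)
    {x a b : V} (hx : RemovalDisconnects G x a b) (j : V) :
    d a j = d x j + d a x ∨ d b j = d x j + d b x := by
  rcases eq_or_ne j x with rfl | hj
  · left
    rw [hd.self, zero_add]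
  · refine (hx.or_of_ne hj).imp (fun h => ?_) fun h => ?_ <;> rw [hadd _ _ _ h, add_comm]

theorem mul_sub_le_mul_sub_of_convexOn_of_monotoneOn (hconv : ConvexOn ℝ (Set.Ici 0) φ)
    (hmono : MonotoneOn φ (Set.Ici 0)) {r s α β : ℝ} (hr : 0 ≤ r) (hs : 0 ≤ s) (hα : 0 < α)
    (hβ : 0 ≤ β) (hsr : s ≤ r + β) : α * (φ s - φ r) ≤ β * (φ (s + α) - φ s) := by
  have hsα : 0 ≤ s + α := by positivity
  have hstep : 0 ≤ φ (s + α) - φ s := sub_nonneg.2 (hmono hs hsα (by linarith))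
  rcases le_or_gt s r with hle | hlt
  · have hneg : φ s - φ r ≤ 0 := sub_nonpos.2 (hmono hs hr hle)
    exact (mul_nonpos_of_nonneg_of_nonpos hα.le hneg).trans (mul_nonneg hβ hstep)
  · have hslope := hconv.slope_mono_adjacent hr hsα hlt (lt_add_of_pos_right s hα)
    rw [add_sub_cancel_left, div_le_div_iff₀ (sub_pos.2 hlt) hα] at hslope
    calc α * (φ s - φ r) = (φ s - φ r) * α := mul_comm _ _
      _ ≤ (φ (s + α) - φ s) * (s - r) := hslope
      _ ≤ (φ (s + α) - φ s) * β := mul_le_mul_of_nonneg_left (by linarith) hstep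
      _ = β * (φ (s + α) - φ s) := mul_comm _ _

theorem AdditiveAcrossCuts.weighted_increment_nonneg (hadd : AdditiveAcrossCuts G d)
    (hd : IsDistance d) (htri : ∀ i j k, d i k ≤ d i j + d j k)
    (hconv : ConvexOn ℝ (Set.Ici 0) φ) (hmono : MonotoneOn φ (Set.Ici 0)) {x a b : V}
    (hx : RemovalDisconnects G x a b) (j : V) :
    0 ≤ d b x * (φ (d a j) - φ (d x j)) + d a x * (φ (d b j) - φ (d x j)) := by
  obtain ⟨ha, hb, -⟩ := id hx
  have hstep : ∀ u v, u ≠ x →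
      d u x * (φ (d x j) - φ (d v j)) ≤ d v x * (φ (d x j + d u x) - φ (d x j)) := fun u v hu =>
    mul_sub_le_mul_sub_of_convexOn_of_monotoneOn hconv hmono (hd.nonneg v j) (hd.nonneg x j)
      (hd.pos u x hu) (hd.nonneg v x) (by linarith [htri x v j, hd.symm x v])
  rcases hadd.eq_add_or_eq_add hd hx j with h | h
  · linarith [h ▸ hstep a b ha]
  · linarith [h ▸ hstep b a hb]

theorem IsMaxVarianceDistribution.pos_subset_not_isCutVertex [Fintype V]
    (hd : IsDistance d) (htri : ∀ i j k, d i k ≤ d i j + d j k) (hadd : AdditiveAcrossCuts G d)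
    (hconv : ConvexOn ℝ (Set.Ici 0) φ) (hmono : StrictMonoOn φ (Set.Ici 0)) {ρ : V → V → ℝ}
    (hρ : ∀ i j, ρ i j ^ 2 = φ (d i j)) {p : V → ℝ} (hp : IsMaxVarianceDistribution ρ p) :
    {x | 0 < p x} ⊆ {x | ¬IsCutVertex G x} := by
  rintro x hpx ⟨a, b, hx⟩
  have hax : 0 < d a x := hd.pos a x hx.1
  have hbx : 0 < d b x := hd.pos b x hx.2.1
  have hincr : ∀ {t}, 0 < t → 0 < φ t - φ 0 := fun ht =>
    sub_pos.2 (hmono (Set.mem_Ici.2 le_rfl) ht.le ht)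
  have hmean : ∀ u, meanSqDist ρ p u ≤ meanSqDist ρ p x :=
    hp.meanSqDist_le_meanSqDist (fun i j => by rw [hρ, hρ, hd.symm]) hpx
  have hpos : 0 < ∑ j, p j *
      (d b x * (φ (d a j) - φ (d x j)) + d a x * (φ (d b j) - φ (d x j))) := by
    refine Finset.sum_pos' (fun j _ => mul_nonneg (hp.1.1 j) <|
      hadd.weighted_increment_nonneg hd htri hconv hmono.monotoneOn hx j)
      ⟨x, Finset.mem_univ x, mul_pos hpx ?_⟩
    rw [hd.self]
    exact add_pos (mul_pos hbx (hincr hax)) (mul_pos hax (hincr hbx))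
  have hsum : ∑ j, p j * (d b x * (φ (d a j) - φ (d x j)) + d a x * (φ (d b j) - φ (d x j))) =
      d b x * (meanSqDist ρ p a - meanSqDist ρ p x) +
        d a x * (meanSqDist ρ p b - meanSqDist ρ p x) := by
    simp only [meanSqDist, hρ, ← Finset.sum_sub_distrib, Finset.mul_sum, ← Finset.sum_add_distrib]
    exact Finset.sum_congr rfl fun j _ => by ring
  linarith [mul_le_mul_of_nonneg_left (hmean a) hbx.le, mul_le_mul_of_nonneg_left (hmean b) hax.le]

end CutVertex

section Tree

variable {V : Type*} {G : SimpleGraph V} {d : V → V → ℝ}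

theorem removalDisconnects_of_mem_support (hG : G.IsAcyclic) {x i j : V} {w : G.Walk i j}
    (hw : w.IsPath) (hx : x ∈ w.support) (hi : i ≠ x) (hj : j ≠ x) :
    RemovalDisconnects G x i j := by
  refine ⟨hi, hj, fun hreach => ?_⟩
  obtain ⟨u, hu⟩ := hreach.exists_isPath
  let f : G.induce {x}ᶜ →g G := (SimpleGraph.Embedding.induce _).toHom
  have hwu : w = u.map f := congrArg Subtype.val <|
    (hG.subsingleton_path i j).elim ⟨w, hw⟩ ⟨u.map f, hu.map Subtype.val_injective⟩
  obtain ⟨y, -, hy⟩ := List.mem_map.1 (u.support_map f ▸ hwu ▸ hx)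
  exact y.2 hy

theorem not_isCutVertex_subset_isLeaf [Nontrivial V] (hG : G.IsTree) :
    {x | ¬IsCutVertex G x} ⊆ {x | IsLeaf G x} := by
  intro x hx
  obtain ⟨a, ha⟩ := hG.connected.preconnected.exists_adj_of_nontrivial x
  refine ⟨a, ha, fun b hb => ?_⟩
  by_contra hba
  let w : G.Walk a b := .cons ha.symm (.cons hb .nil)
  have hw : w.IsPath := by
    simp [w, SimpleGraph.Walk.isPath_def, ha.ne', hb.ne, Ne.symm hba]
  exact hx ⟨a, b, removalDisconnects_of_mem_support hG.isAcyclic hw (by simp [w]) ha.ne' hb.ne'⟩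

theorem AdditiveAcrossCuts.eq_add_of_mem_support (hadd : AdditiveAcrossCuts G d)
    (hd : IsDistance d) (hG : G.IsAcyclic) {x i j : V} {w : G.Walk i j} (hw : w.IsPath)
    (hx : x ∈ w.support) : d i j = d i x + d x j := by
  rcases eq_or_ne i x with rfl | hi
  · rw [hd.self, zero_add]
  rcases eq_or_ne j x with rfl | hj
  · rw [hd.self, add_zero]
  exact hadd x i j (removalDisconnects_of_mem_support hG hw hx hi hj)

theorem AdditiveAcrossCuts.le_add_of_adj (hadd : AdditiveAcrossCuts G d) (hd : IsDistance d)
    (hG : G.IsTree) {i k : V} (hik : G.Adj i k) (j : V) : d i j ≤ d i k + d k j := by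
  obtain ⟨w, hw⟩ := hG.connected.exists_isPath i j
  by_cases hk : k ∈ w.support
  · exact (hadd.eq_add_of_mem_support hd hG.isAcyclic hw hk).le
  · have hkj : d k j = d k i + d i j :=
      hadd.eq_add_of_mem_support hd hG.isAcyclic (w := .cons hik.symm w)
        ((SimpleGraph.Walk.cons_isPath_iff _ _).2 ⟨hw, hk⟩) (by simp)
    linarith [hd.nonneg i k, hd.nonneg k i]

theorem AdditiveAcrossCuts.triangle (hadd : AdditiveAcrossCuts G d) (hd : IsDistance d)
    (hG : G.IsTree) (i k j : V) : d i j ≤ d i k + d k j := by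
  obtain ⟨w, hw⟩ := hG.connected.exists_isPath i k
  induction w with
  | nil => rw [hd.self, zero_add]
  | @cons i l k hil w ih =>
    have hik : d i k = d i l + d l k :=
      hadd.eq_add_of_mem_support hd hG.isAcyclic hw (by simp)
    linarith [hadd.le_add_of_adj hd hG hil j, ih hw.of_cons]

end Tree

theorem mem_of_forall_adj_mem {V : Type*} {G : SimpleGraph V} (hG : G.Preconnected) {S : Set V}
    (hS : ∀ k ∈ S, ∀ l, G.Adj k l → l ∈ S) {k : V} (hk : k ∈ S) (l : V) : l ∈ S := by
  obtain ⟨w⟩ := hG k l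
  induction w with
  | nil => exact hk
  | cons h _ ih => exact ih (hS _ hk _ h)

section MoorePenrose

variable {V : Type*} [Fintype V] {A X : Matrix V V ℝ}

theorem IsMoorePenroseInverse.transpose (h : IsMoorePenroseInverse A X) :
    IsMoorePenroseInverse Aᵀ Xᵀ where
  mul_mul_left := by simpa [Matrix.mul_assoc] using congrArg Matrix.transpose h.mul_mul_left
  mul_mul_right := by simpa [Matrix.mul_assoc] using congrArg Matrix.transpose h.mul_mul_right
  symm_left := by rw [← transpose_mul, h.symm_right, h.symm_right]
  symm_right := by rw [← transpose_mul, h.symm_left, h.symm_left]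

theorem IsMoorePenroseInverse.transpose_eq (h : IsMoorePenroseInverse A X) (hA : Aᵀ = A) :
    Xᵀ = X :=
  IsMoorePenroseInverse.unique (A := A) (by simpa only [hA] using h.transpose) h

theorem IsMoorePenroseInverse.mul_comm (h : IsMoorePenroseInverse A X) (hA : Aᵀ = A) :
    A * X = X * A := by
  rw [← h.symm_left, transpose_mul, hA, h.transpose_eq hA]

end MoorePenrose

namespace WeightedGraph

variable {V : Type*} [Fintype V] [DecidableEq V]

section Laplacian

variable (G : WeightedGraph V)

theorem laplacian_mulVec_apply (v : V → ℝ) (i : V) :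
    (G.laplacian *ᵥ v) i = ∑ k, G.weight i k * (v i - v k) := by
  have hterm : ∀ k, G.laplacian i k * v k =
      (if i = k then (∑ l, G.weight i l) * v i else 0) - G.weight i k * v k := by
    intro k
    rcases eq_or_ne i k with rfl | hik
    · simp [laplacian, G.weight_self]
    · simp [laplacian, hik]
  simp only [mulVec, dotProduct, hterm, Finset.sum_sub_distrib, Finset.sum_ite_eq, Finset.mem_univ,
    if_true, mul_sub, Finset.sum_mul]

theorem laplacian_transpose : G.laplacianᵀ = G.laplacian := by
  ext i j
  rcases eq_or_ne i j with rfl | hij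
  · rfl
  · simp [laplacian, hij, hij.symm, G.weight_symm i j]

theorem sum_laplacian_mulVec (v : V → ℝ) : ∑ i, (G.laplacian *ᵥ v) i = 0 := by
  have hone : G.laplacian *ᵥ 1 = 0 := by
    ext i
    simp [laplacian_mulVec_apply]
  rw [← one_dotProduct, dotProduct_mulVec, ← mulVec_transpose, G.laplacian_transpose, hone,
    zero_dotProduct]

theorem isMoorePenroseInverse_pinv_laplacian :
    IsMoorePenroseInverse G.laplacian (pinv G.laplacian) :=
  pinv_spec G.laplacian_transpose

end Laplacian

section MaximumPrinciple

variable {G : WeightedGraph V} {v : V → ℝ}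

theorem eq_of_adj_of_laplacian_mulVec_nonpos {k l : V} (hv : (G.laplacian *ᵥ v) k ≤ 0)
    (hmax : ∀ m, G.graph.Adj k m → v m ≤ v k) (hkl : G.graph.Adj k l) : v l = v k := by
  have hnonneg : ∀ m ∈ Finset.univ, 0 ≤ G.weight k m * (v k - v m) := by
    intro m _
    rcases (G.weight_nonneg k m).eq_or_lt with hzero | hpos
    · rw [← hzero, zero_mul]
    · exact mul_nonneg hpos.le (sub_nonneg.2 (hmax m hpos))
  rw [laplacian_mulVec_apply] at hv
  have hterm := (Finset.sum_eq_zero_iff_of_nonneg hnonneg).1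
    (hv.antisymm (Finset.sum_nonneg hnonneg)) l (Finset.mem_univ l)
  have hweight : G.weight k l ≠ 0 := ne_of_gt hkl
  exact (sub_eq_zero.1 ((mul_eq_zero.1 hterm).resolve_left hweight)).symm

/-- The maximum principle: if `v` were larger than `v x` somewhere on `C`, the set where it attains
its maximum over `C` would be closed under adjacency without containing `x`. -/
theorem le_of_laplacian_mulVec_nonpos (hG : G.graph.Connected) {C : Set V} {x : V}
    (hC : ∀ k ∈ C, ∀ l, G.graph.Adj k l → l ≠ x → l ∈ C)
    (hv : ∀ k ∈ C, (G.laplacian *ᵥ v) k ≤ 0) {j : V} (hj : j ∈ C) : v j ≤ v x := by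
  by_contra! hlt
  obtain ⟨m, hm, hmax⟩ := Set.exists_max_image C v C.toFinite ⟨j, hj⟩
  have hxm : v x < v m := hlt.trans_le (hmax j hj)
  have hclosed : ∀ k ∈ {k ∈ C | v k = v m}, ∀ l, G.graph.Adj k l → l ∈ {k ∈ C | v k = v m} := by
    rintro k ⟨hk, hkm⟩ l hkl
    have hnbr : ∀ i, G.graph.Adj k i → v i ≤ v k := fun i hi => by
      rcases eq_or_ne i x with rfl | hix
      · exact hkm ▸ hxm.le
      · exact hkm ▸ hmax i (hC k hk i hi hix)
    have hlm : v l = v m := (eq_of_adj_of_laplacian_mulVec_nonpos (hv k hk) hnbr hkl).trans hkm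
    exact ⟨hC k hk l hkl fun hlx => hxm.ne (hlx ▸ hlm), hlm⟩
  exact hxm.ne (mem_of_forall_adj_mem hG.preconnected hclosed ⟨hm, rfl⟩ x).2

theorem le_of_forall_ne_laplacian_mulVec_nonpos (hG : G.graph.Connected) {x : V}
    (hv : ∀ k ≠ x, (G.laplacian *ᵥ v) k ≤ 0) (j : V) : v j ≤ v x := by
  rcases eq_or_ne j x with rfl | hj
  · exact le_rfl
  · exact le_of_laplacian_mulVec_nonpos hG (C := {x}ᶜ) (fun _ _ _ _ h => h) hv hj

theorem eq_of_laplacian_mulVec_eq_zero (hG : G.graph.Connected) (hv : G.laplacian *ᵥ v = 0)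
    (i j : V) : v i = v j := by
  have hle : ∀ i j, v i ≤ v j := fun i j =>
    le_of_forall_ne_laplacian_mulVec_nonpos hG (fun k _ => (congrFun hv k).le) i
  exact (hle i j).antisymm (hle j i)

theorem laplacian_mulVec_pinv_mulVec (hG : G.graph.Connected) {e : V → ℝ} (he : ∑ i, e i = 0) :
    G.laplacian *ᵥ (pinv G.laplacian *ᵥ e) = e := by
  have hpinv := G.isMoorePenroseInverse_pinv_laplacian
  set r := G.laplacian *ᵥ (pinv G.laplacian *ᵥ e) - e with hr
  have hQr : G.laplacian *ᵥ r = 0 := by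
    rw [hr, mulVec_sub, mulVec_mulVec e, hpinv.mul_comm G.laplacian_transpose, mulVec_mulVec,
      ← Matrix.mul_assoc, hpinv.mul_mul_left, sub_self]
  have hsum : ∑ i, r i = 0 := by
    simp only [hr, Pi.sub_apply, Finset.sum_sub_distrib, he, sum_laplacian_mulVec, sub_self]
  refine sub_eq_zero.1 (funext fun i => ?_)
  have hcard : (Fintype.card V : ℝ) * r i = 0 := by
    rw [← hsum, Finset.sum_congr rfl fun j _ => eq_of_laplacian_mulVec_eq_zero hG hQr j i]
    simp
  have : Nonempty V := ⟨i⟩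
  exact (mul_eq_zero.1 hcard).resolve_left (Nat.cast_ne_zero.2 Fintype.card_ne_zero)

end MaximumPrinciple

section EffectiveResistance

/-- The voltage at the nodes when a unit current enters the network at `i` and leaves it at `j`,
normalized to have sum zero. -/
noncomputable def voltage (G : WeightedGraph V) (i j : V) : V → ℝ :=
  pinv G.laplacian *ᵥ (Pi.single i 1 - Pi.single j 1)

theorem effectiveResistance_eq_voltage_sub (G : WeightedGraph V) (i j : V) :
    G.effectiveResistance i j = G.voltage i j i - G.voltage i j j := by
  simp only [effectiveResistance, voltage, sub_dotProduct, single_one_dotProduct]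

theorem voltage_swap (G : WeightedGraph V) (i j : V) : G.voltage j i = -G.voltage i j := by
  rw [voltage, voltage, ← mulVec_neg, neg_sub]

theorem voltage_add_voltage (G : WeightedGraph V) (i x j : V) :
    G.voltage i x + G.voltage x j = G.voltage i j := by
  rw [voltage, voltage, voltage, ← mulVec_add, sub_add_sub_cancel]

theorem voltage_reciprocity (G : WeightedGraph V) (i j k l : V) :
    G.voltage i j k - G.voltage i j l = G.voltage k l i - G.voltage k l j := by
  have hdot : ∀ i j k l, G.voltage i j k - G.voltage i j l =
      (Pi.single k 1 - Pi.single l 1) ⬝ᵥ G.voltage i j := fun i j k l => by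
    simp only [sub_dotProduct, single_one_dotProduct]
  rw [hdot, hdot, voltage, voltage, dotProduct_mulVec, ← mulVec_transpose,
    G.isMoorePenroseInverse_pinv_laplacian.transpose_eq G.laplacian_transpose, dotProduct_comm]

theorem effectiveResistance_eq_add_add (G : WeightedGraph V) (i x j : V) :
    G.effectiveResistance i j = G.effectiveResistance i x + G.effectiveResistance x j +
      2 * (G.voltage i x x - G.voltage i x j) := by
  simp only [effectiveResistance_eq_voltage_sub, ← G.voltage_add_voltage i x j, Pi.add_apply]
  linarith [G.voltage_reciprocity x j i x]

variable {G : WeightedGraph V}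

theorem laplacian_mulVec_voltage (hG : G.graph.Connected) (i j : V) :
    G.laplacian *ᵥ G.voltage i j = Pi.single i 1 - Pi.single j 1 :=
  laplacian_mulVec_pinv_mulVec hG (by simp)

theorem voltage_le_voltage_source (hG : G.graph.Connected) (i j k : V) :
    G.voltage i j k ≤ G.voltage i j i := by
  refine le_of_forall_ne_laplacian_mulVec_nonpos hG (fun l hl => ?_) k
  rw [laplacian_mulVec_voltage hG, Pi.sub_apply, Pi.single_eq_of_ne hl, zero_sub, neg_nonpos]
  exact (Pi.single_nonneg.2 zero_le_one : (0 : V → ℝ) ≤ Pi.single j 1) l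

theorem voltage_sink_le_voltage (hG : G.graph.Connected) (i j k : V) :
    G.voltage i j j ≤ G.voltage i j k := by
  simpa only [G.voltage_swap i j, Pi.neg_apply, neg_le_neg_iff] using
    voltage_le_voltage_source hG j i k

theorem effectiveResistance_pos (hG : G.graph.Connected) {i j : V} (hij : i ≠ j) :
    0 < G.effectiveResistance i j := by
  rw [effectiveResistance_eq_voltage_sub, sub_pos]
  by_contra! hle
  have hconst : ∀ k, G.voltage i j k = G.voltage i j i := fun k =>
    (voltage_le_voltage_source hG i j k).antisymm (hle.trans (voltage_sink_le_voltage hG i j k))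
  have hcurrent := congrFun (laplacian_mulVec_voltage hG i j) i
  rw [laplacian_mulVec_apply] at hcurrent
  simp [hconst, hij] at hcurrent

theorem isDistance_effectiveResistance (hG : G.graph.Connected) :
    IsDistance G.effectiveResistance where
  self i := by rw [effectiveResistance_eq_voltage_sub, sub_self]
  pos _ _ := effectiveResistance_pos hG
  symm i j := by
    simp only [effectiveResistance_eq_voltage_sub, G.voltage_swap i j, Pi.neg_apply]
    ring

theorem effectiveResistance_triangle (hG : G.graph.Connected) (i x j : V) :
    G.effectiveResistance i j ≤ G.effectiveResistance i x + G.effectiveResistance x j := by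
  linarith [G.effectiveResistance_eq_add_add i x j, voltage_sink_le_voltage hG i x j]

/-- No current flows beyond the cut vertex `x`, so the voltage is constant there. -/
theorem voltage_eq_of_removalDisconnects (hG : G.graph.Connected) {x i j : V}
    (h : RemovalDisconnects G.graph x i j) : G.voltage i x j = G.voltage i x x := by
  obtain ⟨hi, hj, hij⟩ := h
  let C : Set V := {k | ∃ hk : k ≠ x, (G.graph.induce {x}ᶜ).Reachable ⟨k, hk⟩ ⟨j, hj⟩}
  have hC : ∀ k ∈ C, ∀ l, G.graph.Adj k l → l ≠ x → l ∈ C := by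
    rintro k ⟨hk, hkj⟩ l hkl hl
    have hlk : (G.graph.induce {x}ᶜ).Adj ⟨l, hl⟩ ⟨k, hk⟩ := hkl.symm
    exact ⟨hl, hlk.reachable.trans hkj⟩
  have hharmonic : ∀ k ∈ C, (G.laplacian *ᵥ G.voltage i x) k ≤ 0 := by
    rintro k ⟨hk, hkj⟩
    have hki : k ≠ i := by
      rintro rfl
      exact hij hkj
    simp [laplacian_mulVec_voltage hG, hk, hki]
  exact (le_of_laplacian_mulVec_nonpos hG hC hharmonic ⟨hj, .rfl⟩).antisymm
    (voltage_sink_le_voltage hG i x j)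

theorem additiveAcrossCuts_effectiveResistance (hG : G.graph.Connected) :
    AdditiveAcrossCuts G.graph G.effectiveResistance := fun x i j h => by
  rw [effectiveResistance_eq_add_add G i x j, voltage_eq_of_removalDisconnects hG h, sub_self,
    mul_zero, add_zero]

end EffectiveResistance

end WeightedGraph

end GraphVariance

open GraphVariance in
theorem mainTheorem3_general {V : Type*} [Fintype V] [DecidableEq V]
    (G : WeightedGraph V) (hG : G.graph.Connected) {φ : ℝ → ℝ}
    (hconv : ConvexOn ℝ (Set.Ici 0) φ) (hmono : StrictMonoOn φ (Set.Ici 0)) :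
    (∀ ρ : V → V → ℝ, (∀ i j, ρ i j ^ 2 = φ (G.effectiveResistance i j)) →
      ∀ p : V → ℝ, IsMaxVarianceDistribution ρ p →
        {i | 0 < p i} ⊆ {i | ¬IsCutVertex G.graph i}) ∧
    ∀ d : V → V → ℝ, IsDistance d → (∀ i j k, d i k ≤ d i j + d j k) →
      AdditiveAcrossCuts G.graph d →
      ∀ ρ : V → V → ℝ, (∀ i j, ρ i j ^ 2 = φ (d i j)) →
        ∀ p : V → ℝ, IsMaxVarianceDistribution ρ p →
          {i | 0 < p i} ⊆ {i | ¬IsCutVertex G.graph i} :=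
  ⟨fun _ hρ _ hp => hp.pos_subset_not_isCutVertex
      (WeightedGraph.isDistance_effectiveResistance hG)
      (WeightedGraph.effectiveResistance_triangle hG)
      (WeightedGraph.additiveAcrossCuts_effectiveResistance hG) hconv hmono hρ,
    fun _ hd htri hadd _ hρ _ hp => hp.pos_subset_not_isCutVertex hd htri hadd hconv hmono hρ⟩

open GraphVariance in
theorem mainTheorem3 {V : Type*} [Fintype V] [DecidableEq V] [Nontrivial V]
    (G : WeightedGraph V) (hG : G.graph.IsTree) :
    -- variance with respect to the square root of the effective resistance
    (∀ p : V → ℝ,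
      IsMaxVarianceDistribution (fun i j => √(G.effectiveResistance i j)) p →
        {i | 0 < p i} ⊆ {i | IsLeaf G.graph i}) ∧
    ∀ d : V → V → ℝ, IsDistance d → AdditiveAcrossCuts G.graph d →
      -- `d` in place of the effective resistance
      (∀ p : V → ℝ, IsMaxVarianceDistribution (fun i j => √(d i j)) p →
        {i | 0 < p i} ⊆ {i | IsLeaf G.graph i}) ∧
      -- variance with respect to `d` itself
      (∀ p : V → ℝ, IsMaxVarianceDistribution d p →
        {i | 0 < p i} ⊆ {i | IsLeaf G.graph i}) := by
  have hleaf := not_isCutVertex_subset_isLeaf hG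
  have hlin := mainTheorem3_general G hG.connected (convexOn_id (convex_Ici 0))
    (strictMono_id.strictMonoOn _)
  have hsq := mainTheorem3_general G hG.connected (convexOn_pow 2)
    (pow_left_strictMonoOn₀ two_ne_zero)
  have hω := WeightedGraph.isDistance_effectiveResistance hG.connected
  refine ⟨fun p hp => (hlin.1 _ (fun i j => Real.sq_sqrt (hω.nonneg i j)) p hp).trans hleaf,
    fun d hd hadd => ⟨fun p hp => ?_, fun p hp => ?_⟩⟩
  · exact (hlin.2 d hd (hadd.triangle hd hG) hadd _
      (fun i j => Real.sq_sqrt (hd.nonneg i j)) p hp).trans hleaf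
  · exact (hsq.2 d hd (hadd.triangle hd hG) hadd d (fun _ _ => rfl) p hp).trans hleaf
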